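/- Let $X$ be a proper $\mathrm{CAT}(0)$ space and $\Gamma$ a group acting properly discontinuously by isometries on $X$. Let $SX$ be the space of geodesics $v\colon\mathbb R\to X$ (isometric embeddings) with the compact-open topology, $(g^t v)(r)=v(t+r)$ the geodesic flow, and $v^{\pm}=\lim_{t\to\pm\infty}v(t)$ the endpoints of $v$ in the ideal boundary $\partial X$, which carries the cone topology. Let $d_T$ be the Tits metric on $\partial X$, i.e. the length metric (with values in $[0,\infty]$) associated with the angular metric $\angle(\xi,\eta)=\sup_{x\in X}\angle_x(\xi,\eta)$; put $\overline{B}_T(\xi,c)=\{\eta : d_T(\xi,\eta)\le c\}$ and $d_T(A,B)=\inf_{\xi\in A,\ \eta\in B}d_T(\xi,\eta)$ (with $\inf\varnothing=\infty$). Let $\mathfrak v\subset SX$ be compact, $\mathfrak v^{\pm}=\{v^{\pm} : v\in\mathfrak v\}$, let $\{U_\lambda\}$ be a family of open subsets of $\partial X$ that covers $\mathfrak v^+$, and let $K\subset\partial X$ be compact. (1) Let $c\in[0,\pi]$. Suppose that for every $\xi\in\mathfrak v^+$ there is some $\lambda$ with $\overline{B}_T(\xi,c)\subseteq U_\lambda$,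 and that $d_T(\mathfrak v^-,K)>\pi-c$. Then there is some $t_0\ge 0$ such that for all $t\ge t_0$ and all $\gamma\in\Gamma$, if $\mathfrak v\cap\gamma g^{-t}\mathfrak v\ne\varnothing$, then $\gamma K\subseteq U_\lambda$ for some $\lambda$. (2) Suppose that $d_T(\mathfrak v^-,K)>\pi$. Then there is some $t_0\ge 0$ such that for all $t\ge t_0$ and all $\gamma\in\Gamma$, if $\mathfrak v\cap\gamma g^{-t}\mathfrak v\ne\varnothing$, then $\gamma K\subseteq U_\lambda$ for some $\lambda$. -/

import Mathlib

open Set Filter Topology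
open scoped NNReal ENNReal

namespace Cat0

noncomputable section

section CAT0

variable {X : Type*} [MetricSpace X]

/-- `u`, restricted to `[0, dist x y]`, is a geodesic segment from `x` to `y`. -/
def IsGeodesicSegment (u : ℝ → X) (x y : X) : Prop :=
  u 0 = x ∧ u (dist x y) = y ∧
    ∀ s ∈ Icc 0 (dist x y), ∀ t ∈ Icc 0 (dist x y), dist (u s) (u t) = |s - t|

variable (X) in
/-- A CAT(0) space: a uniquely geodesic metric space all of whose geodesic triangles are no fatter
than their comparison triangles in the Euclidean plane. Two different sides of a triangle share a
vertex, called `x` here; `x' y' z'` is a comparison triangle, and the points of its sides are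
parametrized proportionally to arc length. -/
structure IsCAT0 : Prop where
  exists_segment : ∀ x y : X, ∃ u : ℝ → X, IsGeodesicSegment u x y
  segment_unique : ∀ (x y : X) (u v : ℝ → X), IsGeodesicSegment u x y → IsGeodesicSegment v x y →
    EqOn u v (Icc 0 (dist x y))
  comparison : ∀ (x y z : X) (u v : ℝ → X), IsGeodesicSegment u x y → IsGeodesicSegment v x z →
    ∀ x' y' z' : EuclideanSpace ℝ (Fin 2),
      dist x' y' = dist x y → dist x' z' = dist x z → dist y' z' = dist y z →
      ∀ s ∈ Icc 0 (dist x y), ∀ t ∈ Icc 0 (dist x z),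
        dist (u s) (v t) ≤
          dist (AffineMap.lineMap x' y' (s / dist x y) : EuclideanSpace ℝ (Fin 2))
            (AffineMap.lineMap x' z' (t / dist x z))

end CAT0

section Boundary

variable (X : Type*) [MetricSpace X]

/-- The space `SX` of geodesics `ℝ → X`, with the compact-open topology. -/
def GeodesicLine : Type _ := {v : C(ℝ, X) // Isometry v}

instance : TopologicalSpace (GeodesicLine X) :=
  inferInstanceAs (TopologicalSpace {v : C(ℝ, X) // Isometry v})

/-- The space of geodesic rays `[0, ∞) → X`, with the compact-open topology. -/
def GeodesicRay : Type _ := {r : C(ℝ≥0, X) // Isometry r}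

instance : TopologicalSpace (GeodesicRay X) :=
  inferInstanceAs (TopologicalSpace {r : C(ℝ≥0, X) // Isometry r})

instance : CoeFun (GeodesicLine X) (fun _ => ℝ → X) := ⟨fun v => v.1⟩

instance : CoeFun (GeodesicRay X) (fun _ => ℝ≥0 → X) := ⟨fun r => r.1⟩

/-- Two geodesic rays are asymptotic if they stay at bounded distance. -/
instance asymptotic : Setoid (GeodesicRay X) where
  r a b := ∃ C : ℝ, ∀ t : ℝ≥0, dist (a t) (b t) ≤ C
  iseqv :=
    { refl := fun _ => ⟨0, fun _ => (dist_self _).le⟩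
      symm := fun ⟨C, h⟩ => ⟨C, fun t => (dist_comm _ _).trans_le (h t)⟩
      trans := fun ⟨C, h⟩ ⟨D, k⟩ =>
        ⟨C + D, fun t => (dist_triangle _ _ _).trans (add_le_add (h t) (k t))⟩ }

/-- The ideal boundary `∂X`. -/
def Boundary : Type _ := Quotient (asymptotic X)

/-- The cone topology, induced by the compact-open topology on the set of rays. -/
instance : TopologicalSpace (Boundary X) :=
  inferInstanceAs (TopologicalSpace (Quotient (asymptotic X)))

variable {X}

/-- The point at infinity of a ray. -/
def GeodesicRay.endpoint (r : GeodesicRay X) : Boundary X := Quotient.mk (asymptotic X) r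

/-- The forward half `t ↦ v t`, `t ≥ 0`, of a geodesic. -/
def GeodesicLine.forwardRay (v : GeodesicLine X) : GeodesicRay X :=
  ⟨⟨fun t => v (t : ℝ), v.1.continuous.comp NNReal.continuous_coe⟩,
    v.2.comp isometry_subtype_coe⟩

/-- The backward half `t ↦ v (-t)`, `t ≥ 0`, of a geodesic. -/
def GeodesicLine.backwardRay (v : GeodesicLine X) : GeodesicRay X :=
  ⟨⟨fun t => v (-(t : ℝ)), v.1.continuous.comp NNReal.continuous_coe.neg⟩,
    v.2.comp ((IsometryEquiv.neg ℝ).isometry.comp isometry_subtype_coe)⟩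

/-- The endpoint `v⁺`. -/
def GeodesicLine.plus (v : GeodesicLine X) : Boundary X := v.forwardRay.endpoint

/-- The endpoint `v⁻`. -/
def GeodesicLine.minus (v : GeodesicLine X) : Boundary X := v.backwardRay.endpoint

/-- The geodesic flow `(gᵗ v) r = v (t + r)`. -/
def geodesicFlow (t : ℝ) (v : GeodesicLine X) : GeodesicLine X :=
  ⟨⟨fun r => v (t + r), v.1.continuous.comp (continuous_const.add continuous_id)⟩,
    v.2.comp (isometry_add_left t)⟩

end Boundary

section Action

variable {Γ X : Type*} [MetricSpace X] [Group Γ] [MulAction Γ X] [IsIsometricSMul Γ X]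

instance : SMul Γ (GeodesicLine X) :=
  ⟨fun γ v => ⟨⟨fun t => γ • v t, (isometry_smul X γ).continuous.comp v.1.continuous⟩,
    (isometry_smul X γ).comp v.2⟩⟩

instance : SMul Γ (GeodesicRay X) :=
  ⟨fun γ r => ⟨⟨fun t => γ • r t, (isometry_smul X γ).continuous.comp r.1.continuous⟩,
    (isometry_smul X γ).comp r.2⟩⟩

/-- The action on `∂X` induced by an isometric action on `X`. -/
instance : SMul Γ (Boundary X) :=
  ⟨fun γ => Quotient.map (fun r : GeodesicRay X => γ • r)
    (fun _ _ ⟨C, h⟩ => ⟨C, fun t => (dist_smul γ _ _).trans_le (h t)⟩)⟩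

end Action

section Tits

variable {X : Type*} [MetricSpace X]

/-- The Euclidean comparison angle at `x` of a triangle with vertices `x, y, z` (for `y ≠ x ≠ z`),
by the law of cosines. -/
def comparisonAngle (x y z : X) : ℝ :=
  Real.arccos ((dist x y ^ 2 + dist x z ^ 2 - dist y z ^ 2) / (2 * dist x y * dist x z))

/-- The Alexandrov angle at the common origin of two geodesic rays. -/
def rayAngle (r r' : GeodesicRay X) : ℝ :=
  limsup (fun p : ℝ≥0 × ℝ≥0 => comparisonAngle (r 0) (r p.1) (r' p.2)) (𝓝[>] 0 ×ˢ 𝓝[>] 0)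

/-- The angular metric on `∂X`: the supremum over all points `x` of `X` of the angle at `x` between
the rays from `x` to `ξ` and to `η`. -/
def angle (ξ η : Boundary X) : ℝ :=
  sSup {a | ∃ r r' : GeodesicRay X, r 0 = r' 0 ∧ r.endpoint = ξ ∧ r'.endpoint = η ∧
    a = rayAngle r r'}

/-- Continuity of the path `c : [0, 1] → ∂X` for the angular metric. -/
def AngleContinuous (c : ℝ → Boundary X) : Prop :=
  ∀ t ∈ Icc (0 : ℝ) 1, ∀ ε > 0, ∃ δ > 0, ∀ s ∈ Icc (0 : ℝ) 1, |s - t| < δ → angle (c s) (c t) < ε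

/-- The length of the path `c : [0, 1] → ∂X` for the angular metric: the supremum, over all finite
subdivisions, of the sums of the distances between successive points. -/
def angleLength (c : ℝ → Boundary X) : ℝ≥0∞ :=
  ⨆ p : ℕ × {u : ℕ → ℝ // Monotone u ∧ ∀ i, u i ∈ Icc (0 : ℝ) 1},
    ∑ i ∈ Finset.range p.1, ENNReal.ofReal (angle (c (p.2.1 i)) (c (p.2.1 (i + 1))))

/-- The Tits metric `d_T` on `∂X`: the length metric associated with the angular metric. It is `∞`
for points that no rectifiable path joins. -/
def titsDist (ξ η : Boundary X) : ℝ≥0∞ :=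
  ⨅ (c : ℝ → Boundary X) (_ : AngleContinuous c ∧ c 0 = ξ ∧ c 1 = η), angleLength c

/-- The Tits distance `d_T(A, B)` of two sets (`∞` if one of them is empty). -/
def titsSetDist (A B : Set (Boundary X)) : ℝ≥0∞ :=
  ⨅ (ξ ∈ A) (η ∈ B), titsDist ξ η

/-- The closed Tits ball of radius `c` about `ξ`. -/
def closedTitsBall (ξ : Boundary X) (c : ℝ) : Set (Boundary X) :=
  {η | titsDist ξ η ≤ ENNReal.ofReal c}

end Tits

end

end Cat0

/-!
Suppose that `v n = γ n g^(-t n) (w n)` with `v n`, `w n` in the compact set `V` and `t n → ∞`, and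
let `ξ n ∈ K`. Along an ultrafilter, `v n → v`, `w n → w`, `ξ n → ξ` and `γ n • ξ n → η`. All claims
follow once `η` is known to be close to `v⁺` when `ξ` is far from `w⁻`.

The triangle with vertices `w n 0`, `w n (-t n)` and `ξ n` has angle sum at most `π`. Since `γ n`
maps its second vertex to `v n 0`, comparison angles at bounded scales satisfy, in the limit,
`∠(w⁻, ξ) + ∠(v⁺, η) ≤ π`. Here the angle `θ` between the endpoints of two rays `r`, `r'` from a
common origin is taken in the form `dist (r t) (r' t) ≤ 2 sin (θ / 2) t` for all `t`. The inequality
then says that the squares of normalized chords sum to at most `4`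
(`Cat0.IsCAT0.chord_sq_add_chord_sq_le`). This form passes to limits, since in the cone topology the
points of the ray from `x` to `ξ` depend continuously on `x` and `ξ` (`Cat0.IsCAT0.tendsto_ray`);
the result is `Cat0.IsCAT0.exists_forall_smul_subset`.

The link with the Tits metric is the bound `d_T ≤ θ` for angles `θ < π`
(`Cat0.IsCAT0.titsDist_le`). The segments from `r T` to `r' T` stay at distance at least
`T (1 - sin (θ / 2))` from the origin, so their points converge to points at infinity as `T → ∞`.
If these points are chosen to divide the comparison angle at the origin evenly, then by
Alexandrov's lemma (`Cat0.IsCAT0.comparisonAngle_add_le`) the limits form a `θ`-Lipschitz path from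
the endpoint of `r` to that of `r'`.

Let `α` be the angle between `w⁻` and `ξ` (`Cat0.AnglesAddLePi.dichotomy`). If `α = π`, then the
angle between `v⁺` and `η` is `0`, whence `η = v⁺`. Otherwise `d_T(w⁻, ξ) ≤ α < π`. This is
impossible if `d_T(w⁻, ξ) > π`; and if `d_T(w⁻, ξ) > π - c`, then `π - α < c ≤ π`, so that
`d_T(v⁺, η) ≤ π - α ≤ c`. Only upper bounds for the Tits metric are needed.
-/

namespace Cat0

/-! ### Comparison triangles and the law of cosines -/

section Comparison

variable {X : Type*} [MetricSpace X]

/-- A triangle in the Euclidean plane with prescribed side lengths. -/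
theorem exists_comparison_triangle {P Q d : ℝ} (hP : 0 < P) (hQ : 0 < Q) (hd : 0 ≤ d)
    (h₁ : d ≤ P + Q) (h₂ : |P - Q| ≤ d) :
    ∃ x y z : EuclideanSpace ℝ (Fin 2), dist x y = P ∧ dist x z = Q ∧ dist y z = d := by
  set k := (P ^ 2 + Q ^ 2 - d ^ 2) / (2 * P * Q) with hk
  have hPQ : 0 < 2 * P * Q := by positivity
  have hk2 : 2 * P * Q * k = P ^ 2 + Q ^ 2 - d ^ 2 := by rw [hk]; field_simp
  have hdd : (P - Q) ^ 2 ≤ d ^ 2 := sq_le_sq.2 (h₂.trans (le_abs_self d))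
  have hk1 : k ^ 2 ≤ 1 := by
    rw [sq_le_one_iff_abs_le_one, abs_le]
    constructor
    · rw [hk, le_div_iff₀ hPQ]; nlinarith
    · rw [hk, div_le_one hPQ]; nlinarith
  have hs : √(1 - k ^ 2) ^ 2 = 1 - k ^ 2 := Real.sq_sqrt (by linarith)
  refine ⟨0, !₂[P, 0], !₂[Q * k, Q * √(1 - k ^ 2)], ?_, ?_, ?_⟩
  · rw [EuclideanSpace.dist_eq]
    simp [Fin.sum_univ_two, hP.le]
  · rw [EuclideanSpace.dist_eq, Real.sqrt_eq_iff_eq_sq (by positivity) hQ.le]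
    simp only [Fin.sum_univ_two, Real.dist_eq, sq_abs]
    simp
    linear_combination Q ^ 2 * hs
  · rw [EuclideanSpace.dist_eq, Real.sqrt_eq_iff_eq_sq (by positivity) hd]
    simp only [Fin.sum_univ_two, Real.dist_eq, sq_abs]
    simp
    linear_combination Q ^ 2 * hs - hk2

/-- The `CAT(0)` inequality in the form of a law of cosines: the cosine of the comparison angle
at `x` can only grow when the other two vertices are moved towards `x`. -/
theorem IsCAT0.dist_sq_le (hX : IsCAT0 X) {x y z : X} {u v : ℝ → X}
    (hu : IsGeodesicSegment u x y) (hv : IsGeodesicSegment v x z) (hxy : x ≠ y) (hxz : x ≠ z)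
    {s t : ℝ} (hs : s ∈ Icc 0 (dist x y)) (ht : t ∈ Icc 0 (dist x z)) :
    dist (u s) (v t) ^ 2 ≤ s ^ 2 + t ^ 2 -
      s * t * ((dist x y ^ 2 + dist x z ^ 2 - dist y z ^ 2) / (dist x y * dist x z)) := by
  have hP : 0 < dist x y := dist_pos.2 hxy
  have hQ : 0 < dist x z := dist_pos.2 hxz
  obtain ⟨x', y', z', h1, h2, h3⟩ := exists_comparison_triangle hP hQ
    (dist_nonneg (x := y) (y := z))
    (by linarith [dist_triangle y x z, dist_comm x y])
    (by
      have h := abs_dist_sub_le y z x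
      rwa [dist_comm y x, dist_comm z x] at h)
  refine (pow_le_pow_left₀ dist_nonneg
    (hX.comparison x y z u v hu hv x' y' z' h1 h2 h3 s hs t ht) 2).trans (le_of_eq ?_)
  set P := dist x y
  set Q := dist x z
  have e1 : ‖y' - x'‖ ^ 2 = P ^ 2 := by rw [← dist_eq_norm, dist_comm, h1]
  have e2 : ‖z' - x'‖ ^ 2 = Q ^ 2 := by rw [← dist_eq_norm, dist_comm, h2]
  have e3 : ‖(y' - x') - (z' - x')‖ ^ 2 = dist y z ^ 2 := by
    rw [sub_sub_sub_cancel_right, ← dist_eq_norm, h3]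
  rw [norm_sub_sq_real, e1, e2] at e3
  have e4 : dist (AffineMap.lineMap x' y' (s / P) : EuclideanSpace ℝ (Fin 2))
      (AffineMap.lineMap x' z' (t / Q)) = ‖(s / P) • (y' - x') - (t / Q) • (z' - x')‖ := by
    rw [dist_eq_norm]
    congr 1
    simp [AffineMap.lineMap_apply]
  rw [e4, norm_sub_sq_real, norm_smul, norm_smul, mul_pow, mul_pow, e1, e2, inner_smul_left,
    inner_smul_right, Real.norm_eq_abs, Real.norm_eq_abs, sq_abs, sq_abs, ← e3]
  simp only [conj_trivial]
  field_simp
  ring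

theorem IsGeodesicSegment.symm {u : ℝ → X} {x y : X} (hu : IsGeodesicSegment u x y) :
    IsGeodesicSegment (fun t => u (dist x y - t)) y x := by
  obtain ⟨h0, h1, h2⟩ := hu
  refine ⟨by simpa using h1, by simpa [dist_comm y x] using h0, fun s hs t ht => ?_⟩
  rw [dist_comm y x] at hs ht
  rw [h2 _ ⟨by linarith [hs.2], by linarith [hs.1]⟩ _ ⟨by linarith [ht.2], by linarith [ht.1]⟩,
    abs_sub_comm]
  congr 1
  ring

theorem IsGeodesicSegment.dist_left {u : ℝ → X} {x y : X} (hu : IsGeodesicSegment u x y)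
    {t : ℝ} (ht : t ∈ Icc 0 (dist x y)) : dist x (u t) = t := by
  have h := hu.2.2 0 ⟨le_rfl, dist_nonneg⟩ t ht
  rwa [hu.1, zero_sub, abs_neg, abs_of_nonneg ht.1] at h

theorem IsGeodesicSegment.dist_right {u : ℝ → X} {x y : X} (hu : IsGeodesicSegment u x y)
    {t : ℝ} (ht : t ∈ Icc 0 (dist x y)) : dist (u t) y = dist x y - t := by
  have h := hu.2.2 t ht _ ⟨dist_nonneg, le_rfl⟩
  rwa [hu.2.1, abs_sub_comm, abs_of_nonneg (by linarith [ht.2])] at h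

theorem IsGeodesicSegment.restrict {u : ℝ → X} {x y : X} (hu : IsGeodesicSegment u x y)
    {t : ℝ} (ht : t ∈ Icc 0 (dist x y)) : IsGeodesicSegment u x (u t) := by
  have h := hu.dist_left ht
  refine ⟨hu.1, by rw [h], fun a ha b hb => ?_⟩
  rw [h] at ha hb
  exact hu.2.2 a ⟨ha.1, ha.2.trans ht.2⟩ b ⟨hb.1, hb.2.trans ht.2⟩

/-- Points at the same distance from the common origin of two segments are at most as far apart as
the ends of the segments. -/
theorem IsCAT0.dist_segments_le (hX : IsCAT0 X) {x y z : X} {u v : ℝ → X}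
    (hu : IsGeodesicSegment u x y) (hv : IsGeodesicSegment v x z)
    {t : ℝ} (h0 : 0 ≤ t) (hy : t ≤ dist x y) (hz : t ≤ dist x z) :
    dist (u t) (v t) ≤ dist y z := by
  rcases h0.eq_or_lt with rfl | h0
  · rw [hu.1, hv.1, dist_self]; exact dist_nonneg
  have hP : 0 < dist x y := h0.trans_le hy
  have hQ : 0 < dist x z := h0.trans_le hz
  have h := hX.dist_sq_le hu hv (dist_pos.1 hP) (dist_pos.1 hQ) ⟨h0.le, hy⟩ ⟨h0.le, hz⟩
  set P := dist x y
  set Q := dist x z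
  refine le_of_sq_le_sq ?_ dist_nonneg
  refine h.trans ?_
  have e : t ^ 2 + t ^ 2 - t * t * ((P ^ 2 + Q ^ 2 - dist y z ^ 2) / (P * Q)) =
      t ^ 2 * (dist y z ^ 2 - (P - Q) ^ 2) / (P * Q) := by field_simp; ring
  rw [e, div_le_iff₀ (by positivity)]
  have h1 : t ^ 2 ≤ P * Q := by nlinarith
  have h2 : (P - Q) ^ 2 ≤ dist y z ^ 2 := by
    have h := abs_dist_sub_le y z x
    rw [dist_comm y x, dist_comm z x] at h
    exact sq_le_sq.2 (h.trans (le_abs_self _))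
  nlinarith [sq_nonneg (P - Q)]

/-- Two segments ending at the same point, parametrized by arc length from their origins, stay
within twice the distance of their origins. -/
theorem IsCAT0.dist_segments_le_two_mul (hX : IsCAT0 X) {x x' p : X} {u v : ℝ → X}
    (hu : IsGeodesicSegment u x p) (hv : IsGeodesicSegment v x' p)
    {t : ℝ} (h0 : 0 ≤ t) (hx : t ≤ dist x p) (hx' : t ≤ dist x' p) :
    dist (u t) (v t) ≤ 2 * dist x x' := by
  -- `m` is the smaller of the two distances to `p`, up to which both segments are run backwards
  obtain ⟨m, hm1, hm2, hm3⟩ : ∃ m, m ≤ dist x p ∧ m ≤ dist x' p ∧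
      (m = dist x p ∨ m = dist x' p) := by
    rcases le_total (dist x p) (dist x' p) with h | h
    · exact ⟨_, le_rfl, h, Or.inl rfl⟩
    · exact ⟨_, h, le_rfl, Or.inr rfl⟩
  have htm : t ≤ m := by rcases hm3 with h | h <;> simpa [h]
  have h := hX.dist_segments_le hu.symm hv.symm (t := m - t) (by linarith)
    (by rw [dist_comm]; linarith) (by rw [dist_comm]; linarith)
  have h1 := hu.2.2 t ⟨h0, hx⟩ (dist x p - (m - t)) ⟨by linarith, by linarith⟩
  have h2 := hv.2.2 (dist x' p - (m - t)) ⟨by linarith, by linarith⟩ t ⟨h0, hx'⟩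
  have h3 := dist_triangle4 (u t) (u (dist x p - (m - t))) (v (dist x' p - (m - t))) (v t)
  have h4 := dist_triangle x x' p
  have h5 := dist_triangle x' x p
  rw [dist_comm x' x] at h5
  rw [abs_of_nonpos (by linarith)] at h1
  rw [abs_of_nonneg (by linarith)] at h2
  rcases hm3 with h | h <;> linarith

/-! ### Comparison angles -/

theorem comparisonAngle_mem (x y z : X) : comparisonAngle x y z ∈ Icc 0 Real.pi :=
  ⟨Real.arccos_nonneg _, Real.arccos_le_pi _⟩

theorem comparisonAngle_comm (x y z : X) : comparisonAngle x y z = comparisonAngle x z y := by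
  unfold comparisonAngle
  rw [dist_comm y z, add_comm (dist x y ^ 2), mul_right_comm]

theorem comparisonAngle_self {x y : X} (h : x ≠ y) : comparisonAngle x y y = 0 := by
  have := dist_pos.2 h
  unfold comparisonAngle
  rw [Real.arccos_eq_zero, dist_self]
  rw [le_div_iff₀ (by positivity)]
  linarith

/-- The law of cosines for the comparison angle. -/
theorem cos_comparisonAngle {x y z : X} (hy : x ≠ y) (hz : x ≠ z) :
    2 * dist x y * dist x z * Real.cos (comparisonAngle x y z) =
      dist x y ^ 2 + dist x z ^ 2 - dist y z ^ 2 := by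
  have hP := dist_pos.2 hy
  have hQ := dist_pos.2 hz
  have h1 := dist_triangle_left y z x
  have h2 : (dist x y - dist x z) ^ 2 ≤ dist y z ^ 2 := by
    have h := abs_dist_sub_le y z x
    rw [dist_comm y x, dist_comm z x] at h
    exact sq_le_sq.2 (h.trans (le_abs_self _))
  have h3 : 0 ≤ dist y z := dist_nonneg
  unfold comparisonAngle
  rw [Real.cos_arccos]
  · field_simp
  · rw [le_div_iff₀ (by positivity)]; nlinarith
  · rw [div_le_one (by positivity)]; nlinarith

/-- The cosines of two angles of a Euclidean triangle have nonnegative sum, as the angles add up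
to at most `π`. -/
theorem cos_comparisonAngle_add_nonneg {x y z : X} (hy : x ≠ y) (hz : x ≠ z) (hyz : y ≠ z) :
    0 ≤ Real.cos (comparisonAngle x y z) + Real.cos (comparisonAngle y x z) := by
  have h1 := cos_comparisonAngle hy hz
  have h2 := cos_comparisonAngle hy.symm hyz
  rw [dist_comm y x] at h2
  have hA := dist_pos.2 hy
  have hB := dist_pos.2 hz
  have hC := dist_pos.2 hyz
  have h3 : (dist x z - dist y z) ^ 2 ≤ dist x y ^ 2 :=
    sq_le_sq.2 ((abs_dist_sub_le x y z).trans (le_abs_self _))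
  set A := dist x y
  set B := dist x z
  set C := dist y z
  set k := Real.cos (comparisonAngle x y z)
  set l := Real.cos (comparisonAngle y x z)
  have h4 : 2 * A * B * C * (k + l) = (B + C) * (A ^ 2 - (B - C) ^ 2) := by
    linear_combination C * h1 + B * h2
  have h5 : 0 ≤ 2 * A * B * C * (k + l) := by
    rw [h4]; exact mul_nonneg (by positivity) (by linarith)
  exact nonneg_of_mul_nonneg_right h5 (by positivity)

/-- Comparison angles do not grow when the other two vertices are moved towards `x`. -/
theorem IsCAT0.comparisonAngle_le (hX : IsCAT0 X) {x y z : X} {u v : ℝ → X}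
    (hu : IsGeodesicSegment u x y) (hv : IsGeodesicSegment v x z)
    {s t : ℝ} (hs : 0 < s) (hs' : s ≤ dist x y) (ht : 0 < t) (ht' : t ≤ dist x z) :
    comparisonAngle x (u s) (v t) ≤ comparisonAngle x y z := by
  have hP : 0 < dist x y := hs.trans_le hs'
  have hQ : 0 < dist x z := ht.trans_le ht'
  have h := hX.dist_sq_le hu hv (dist_pos.1 hP) (dist_pos.1 hQ) ⟨hs.le, hs'⟩ ⟨ht.le, ht'⟩
  unfold comparisonAngle
  rw [hu.dist_left ⟨hs.le, hs'⟩, hv.dist_left ⟨ht.le, ht'⟩]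
  apply Real.arccos_le_arccos
  rw [le_div_iff₀ (by positivity)]
  refine le_trans (le_of_eq ?_) (sub_le_sub_left h _)
  field_simp
  ring

/-- Stewart's theorem becomes an inequality in a `CAT(0)` space. -/
theorem IsCAT0.stewart (hX : IsCAT0 X) {x y z : X} {u : ℝ → X} (hu : IsGeodesicSegment u y z)
    {t : ℝ} (ht : t ∈ Icc 0 (dist y z)) (hxy : x ≠ y) (hyz : y ≠ z) :
    dist x (u t) ^ 2 * dist y z ≤ dist x y ^ 2 * (dist y z - t) + dist x z ^ 2 * t -
      t * (dist y z - t) * dist y z := by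
  obtain ⟨v, hv⟩ := hX.exists_segment y x
  have hP := dist_pos.2 hxy.symm
  have hQ := dist_pos.2 hyz
  have h := hX.dist_sq_le hv hu hxy.symm hyz ⟨dist_nonneg, le_rfl⟩ ht
  rw [hv.2.1] at h
  refine (mul_le_mul_of_nonneg_right h hQ.le).trans (le_of_eq ?_)
  rw [dist_comm x y]
  field_simp
  ring

/-- Alexandrov's lemma: a point on the side opposite to `x` cuts the comparison angle at `x` into
comparison angles with at most the same sum. -/
theorem IsCAT0.comparisonAngle_add_le (hX : IsCAT0 X) {x y z : X} {u : ℝ → X}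
    (hu : IsGeodesicSegment u y z) {t : ℝ} (ht : t ∈ Icc 0 (dist y z)) (hxy : x ≠ y)
    (hxu : x ≠ u t) (hxz : x ≠ z) :
    comparisonAngle x y (u t) + comparisonAngle x (u t) z ≤ comparisonAngle x y z := by
  rcases ht.1.eq_or_lt with h0 | h0
  · rw [← h0, hu.1, comparisonAngle_self hxy, zero_add]
  rcases ht.2.eq_or_lt with h1 | h1
  · rw [h1, hu.2.1, comparisonAngle_self hxz, add_zero]
  have hd := hu.dist_left ht
  have he := hu.dist_right ht
  have hyu : y ≠ u t := dist_pos.1 (by rw [hd]; exact h0)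
  have huz : u t ≠ z := dist_pos.1 (by rw [he]; linarith)
  have hyz : y ≠ z := dist_pos.1 (h0.trans h1)
  have hst := hX.stewart hu ht hxy hyz
  set p := u t
  have ha := dist_pos.2 hxy
  have hb := dist_pos.2 hxu
  have hc := dist_pos.2 hxz
  have c1 := cos_comparisonAngle hxy hxu
  have c2 := cos_comparisonAngle hxu hxz
  have c3 := cos_comparisonAngle hxy hxz
  have p1 := cos_comparisonAngle hxu.symm hyu.symm
  have p2 := cos_comparisonAngle hxu.symm huz
  have s1 := cos_comparisonAngle_add_nonneg hxu hxy hyu.symm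
  have s2 := cos_comparisonAngle_add_nonneg hxu hxz huz
  rw [comparisonAngle_comm x p y] at s1
  have m1 := comparisonAngle_mem x y p
  have m2 := comparisonAngle_mem x p z
  have m3 := comparisonAngle_mem x y z
  rw [dist_comm p x, dist_comm p y, hd] at p1
  rw [dist_comm p x, he] at p2
  rw [hd] at c1
  rw [he] at c2
  set φ₁ := comparisonAngle x y p
  set φ₂ := comparisonAngle x p z
  set φ := comparisonAngle x y z
  set a := dist x y
  set b := dist x p
  set c := dist x z
  set L := dist y z
  have hLt : 0 < L - t := by linarith
  -- the two comparison angles at `p` add up to at least `π`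
  have hp : Real.cos (comparisonAngle p x y) + Real.cos (comparisonAngle p x z) ≤ 0 := by
    have h : 2 * b * t * (L - t) *
        (Real.cos (comparisonAngle p x y) + Real.cos (comparisonAngle p x z)) ≤ 0 := by
      have e : 2 * b * t * (L - t) *
          (Real.cos (comparisonAngle p x y) + Real.cos (comparisonAngle p x z)) =
          (b ^ 2 + t ^ 2 - a ^ 2) * (L - t) + (b ^ 2 + (L - t) ^ 2 - c ^ 2) * t := by
        linear_combination (L - t) * p1 + t * p2
      rw [e]; nlinarith
    by_contra hcon
    exact absurd h (not_le.2 (mul_pos (by positivity) (not_le.1 hcon)))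
  have hpi : φ₁ + φ₂ ≤ Real.pi := by
    by_contra hcon
    have h := Real.cos_lt_cos_of_nonneg_of_le_pi (x := Real.pi - φ₂) (y := φ₁)
      (by linarith [m2.2]) m1.2 (by linarith)
    rw [Real.cos_pi_sub] at h
    linarith
  -- the hinge formed by the two comparison triangles, drawn in the complex plane
  have hhinge : a ^ 2 + c ^ 2 - 2 * a * c * Real.cos (φ₁ + φ₂) ≤ L ^ 2 := by
    have n1 : ‖(⟨a * Real.cos φ₁, a * Real.sin φ₁⟩ : ℂ) - ⟨b, 0⟩‖ = t := by
      rw [← sq_eq_sq₀ (norm_nonneg _) h0.le, Complex.sq_norm, Complex.normSq_apply]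
      simp only [Complex.sub_re, Complex.sub_im]
      linear_combination a ^ 2 * Real.sin_sq_add_cos_sq φ₁ - c1
    have n2 : ‖(⟨b, 0⟩ : ℂ) - ⟨c * Real.cos φ₂, -(c * Real.sin φ₂)⟩‖ = L - t := by
      rw [← sq_eq_sq₀ (norm_nonneg _) hLt.le, Complex.sq_norm, Complex.normSq_apply]
      simp only [Complex.sub_re, Complex.sub_im]
      linear_combination c ^ 2 * Real.sin_sq_add_cos_sq φ₂ - c2
    have n3 := norm_sub_le_norm_sub_add_norm_sub
      (⟨a * Real.cos φ₁, a * Real.sin φ₁⟩ : ℂ) ⟨b, 0⟩ ⟨c * Real.cos φ₂, -(c * Real.sin φ₂)⟩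
    rw [n1, n2, add_sub_cancel] at n3
    refine le_trans (le_of_eq ?_) (pow_le_pow_left₀ (norm_nonneg _) n3 2)
    rw [Complex.sq_norm, Complex.normSq_apply, Real.cos_add]
    simp only [Complex.sub_re, Complex.sub_im]
    linear_combination -a ^ 2 * Real.sin_sq_add_cos_sq φ₁ - c ^ 2 * Real.sin_sq_add_cos_sq φ₂
  have hcos : Real.cos φ ≤ Real.cos (φ₁ + φ₂) := by
    have h : 2 * a * c * Real.cos φ ≤ 2 * a * c * Real.cos (φ₁ + φ₂) := by linarith
    exact le_of_mul_le_mul_left h (by positivity)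
  by_contra hcon
  exact absurd (Real.cos_lt_cos_of_nonneg_of_le_pi m3.1 hpi (not_le.1 hcon)) (not_lt.2 hcos)

end Comparison

/-! ### Asymptotic rays -/

section Rays

variable {X : Type*} [MetricSpace X]

theorem GeodesicRay.dist_eq (r : GeodesicRay X) (s t : ℝ≥0) :
    dist (r s) (r t) = |(s : ℝ) - t| := by
  rw [r.2.dist_eq, NNReal.dist_eq]

theorem GeodesicRay.dist_zero_left (r : GeodesicRay X) (t : ℝ≥0) : dist (r 0) (r t) = t := by
  simp [r.dist_eq]

theorem GeodesicRay.isGeodesicSegment (r : GeodesicRay X) (T : ℝ≥0) :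
    IsGeodesicSegment (fun t : ℝ => r t.toNNReal) (r 0) (r T) := by
  rw [IsGeodesicSegment, r.dist_zero_left]
  refine ⟨by simp, by simp, fun s hs t ht => ?_⟩
  rw [r.dist_eq, Real.coe_toNNReal _ hs.1, Real.coe_toNNReal _ ht.1]

theorem GeodesicRay.endpoint_eq_iff {r r' : GeodesicRay X} :
    r.endpoint = r'.endpoint ↔ ∃ C : ℝ, ∀ t : ℝ≥0, dist (r t) (r' t) ≤ C :=
  Quotient.eq

@[ext]
theorem GeodesicRay.ext {r r' : GeodesicRay X} (h : ∀ t, r t = r' t) : r = r' :=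
  Subtype.ext (ContinuousMap.ext h)

/-- An ultralimit of maps each of whose distances is eventually the one in `[0, ∞)` is a ray. -/
theorem exists_ray_of_ultrafilter [ProperSpace X] {ι : Type*} (F : Ultrafilter ι)
    (g : ι → ℝ → X) {x : X} (h0 : Tendsto (fun i => g i 0) F (𝓝 x))
    (hg : ∀ s t : ℝ, 0 ≤ s → 0 ≤ t → ∀ᶠ i in (F : Filter ι), dist (g i s) (g i t) = |s - t|) :
    ∃ r : GeodesicRay X, r 0 = x ∧ ∀ t : ℝ≥0, Tendsto (fun i => g i t) F (𝓝 (r t)) := by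
  have key : ∀ t : ℝ≥0, ∃ y, Tendsto (fun i => g i t) F (𝓝 y) := by
    intro t
    have hev : ∀ᶠ i in (F : Filter ι), g i t ∈ Metric.closedBall x (t + 1) := by
      filter_upwards [hg t 0 t.2 le_rfl, Metric.tendsto_nhds.1 h0 1 one_pos] with i h1 h2
      rw [Metric.mem_closedBall]
      have h3 := dist_triangle (g i t) (g i 0) x
      rw [sub_zero, abs_of_nonneg t.coe_nonneg] at h1
      linarith
    obtain ⟨y, -, hy⟩ := (isCompact_closedBall x (t + 1)).ultrafilter_le_nhds
      (F.map fun i => g i t) (le_principal_iff.2 hev)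
    exact ⟨y, hy⟩
  choose f hf using key
  have hiso : Isometry f := by
    refine Isometry.of_dist_eq fun s t => ?_
    refine tendsto_nhds_unique ((hf s).dist (hf t)) ?_
    rw [NNReal.dist_eq]
    refine Tendsto.congr' ?_ tendsto_const_nhds
    filter_upwards [hg s t s.2 t.2] with i hi using hi.symm
  exact ⟨⟨⟨f, hiso.continuous⟩, hiso⟩, tendsto_nhds_unique (hf 0) h0, hf⟩

/-- An ultralimit of segments from `x` whose lengths tend to infinity is a ray. -/
theorem exists_ray_of_segments [ProperSpace X] {ι : Type*} (F : Ultrafilter ι) {x : X}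
    {q : ι → X} {u : ι → ℝ → X} (hu : ∀ i, IsGeodesicSegment (u i) x (q i))
    (hq : Tendsto (fun i => dist x (q i)) F atTop) :
    ∃ r : GeodesicRay X, r 0 = x ∧ ∀ t : ℝ≥0, Tendsto (fun i => u i t) F (𝓝 (r t)) := by
  refine exists_ray_of_ultrafilter F u ?_ fun s t hs ht => ?_
  · simp [(hu _).1]
  · filter_upwards [hq.eventually_ge_atTop (max s t)] with i hi
    exact (hu i).2.2 s ⟨hs, (le_max_left _ _).trans hi⟩ t ⟨ht, (le_max_right _ _).trans hi⟩

/-- The distance between two rays from the same origin, divided by the time, is nondecreasing. -/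
theorem IsCAT0.dist_ray_mul_le (hX : IsCAT0 X) {r r' : GeodesicRay X} (h0 : r 0 = r' 0)
    {t T : ℝ≥0} (htT : t ≤ T) : dist (r t) (r' t) * T ≤ t * dist (r T) (r' T) := by
  rcases eq_zero_or_pos T with rfl | hT
  · simp [le_zero_iff.1 htT]
  have hT' : (0 : ℝ) < T := hT
  have htT' : (t : ℝ) ≤ T := htT
  have hu := r.isGeodesicSegment T
  have hv := r'.isGeodesicSegment T
  have d1 := r.dist_zero_left T
  have d2 := r'.dist_zero_left T
  rw [← h0] at hv d2
  have h := hX.dist_sq_le hu hv (dist_pos.1 (by rw [d1]; exact hT'))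
    (dist_pos.1 (by rw [d2]; exact hT'))
    (s := t) (t := t) (by rw [d1]; exact ⟨t.2, htT'⟩) (by rw [d2]; exact ⟨t.2, htT'⟩)
  simp only [Real.toNNReal_coe] at h
  rw [d1, d2] at h
  refine le_of_sq_le_sq ?_ (by positivity)
  rw [mul_pow, mul_pow]
  calc _ ≤ _ := mul_le_mul_of_nonneg_right h (by positivity)
    _ = _ := by field_simp; ring

theorem IsCAT0.ray_eq_of_endpoint_eq (hX : IsCAT0 X) {r r' : GeodesicRay X} (h0 : r 0 = r' 0)
    (h : r.endpoint = r'.endpoint) : r = r' := by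
  obtain ⟨C, hC⟩ := GeodesicRay.endpoint_eq_iff.1 h
  ext t
  rw [← dist_le_zero]
  have hlim : Tendsto (fun T : ℝ≥0 => t * C / (T : ℝ)) atTop (𝓝 0) :=
    tendsto_const_nhds.div_atTop (NNReal.tendsto_coe_atTop.2 tendsto_id)
  refine ge_of_tendsto hlim ?_
  filter_upwards [eventually_ge_atTop t, eventually_gt_atTop 0] with T hT hT0
  rw [le_div_iff₀ (by exact_mod_cast hT0)]
  exact (hX.dist_ray_mul_le h0 hT).trans (mul_le_mul_of_nonneg_left (hC T) t.2)

/-- From every point there is a ray asymptotic to a given ray `r`, namely an ultralimit of the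
segments to the points of `r`. -/
theorem IsCAT0.exists_asymptotic_ray [ProperSpace X] (hX : IsCAT0 X) (x : X) (r : GeodesicRay X) :
    ∃ r' : GeodesicRay X, r' 0 = x ∧ (∀ t, dist (r' t) (r t) ≤ 2 * dist x (r 0)) ∧
      ∃ (F : Ultrafilter ℝ≥0) (u : ℝ≥0 → ℝ → X), (F : Filter ℝ≥0) ≤ atTop ∧
        (∀ T, IsGeodesicSegment (u T) x (r T)) ∧
        ∀ t : ℝ≥0, Tendsto (fun T => u T t) F (𝓝 (r' t)) := by
  choose u hu using fun T : ℝ≥0 => hX.exists_segment x (r T)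
  have hlen : ∀ T : ℝ≥0, (T : ℝ) - dist x (r 0) ≤ dist x (r T) := fun T => by
    have h := dist_triangle_left (r 0) (r T) x
    rw [r.dist_zero_left] at h
    linarith
  have hF : ((Ultrafilter.of (atTop : Filter ℝ≥0) : Ultrafilter ℝ≥0) : Filter ℝ≥0) ≤ atTop :=
    Ultrafilter.of_le _
  have hq : Tendsto (fun T : ℝ≥0 => dist x (r T)) atTop atTop :=
    tendsto_atTop_mono hlen
      (tendsto_atTop_add_const_right _ _ (NNReal.tendsto_coe_atTop.2 tendsto_id))
  obtain ⟨r', h0, hr'⟩ := exists_ray_of_segments (Ultrafilter.of atTop) hu (hq.mono_left hF)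
  refine ⟨r', h0, fun t => ?_, _, u, hF, hu, hr'⟩
  refine le_of_tendsto ((hr' t).dist tendsto_const_nhds) ?_
  filter_upwards [hF (hq.eventually_ge_atTop t), hF (eventually_ge_atTop t)] with T h1 h2
  have h := hX.dist_segments_le_two_mul (hu T) (r.isGeodesicSegment T) t.2 h1
    (by rw [r.dist_zero_left]; exact h2)
  simpa using h

theorem IsCAT0.exists_ray_from [ProperSpace X] (hX : IsCAT0 X) (x : X) (ξ : Boundary X) :
    ∃ r : GeodesicRay X, r 0 = x ∧ r.endpoint = ξ := by
  obtain ⟨r, rfl⟩ := Quotient.exists_rep ξ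
  obtain ⟨r', h0, hr', -⟩ := hX.exists_asymptotic_ray x r
  exact ⟨r', h0, GeodesicRay.endpoint_eq_iff.2 ⟨_, hr'⟩⟩

theorem IsCAT0.dist_le_of_endpoint_eq [ProperSpace X] (hX : IsCAT0 X) {r r' : GeodesicRay X}
    (h : r.endpoint = r'.endpoint) (t : ℝ≥0) : dist (r t) (r' t) ≤ 2 * dist (r 0) (r' 0) := by
  obtain ⟨r'', h0, hr'', -⟩ := hX.exists_asymptotic_ray (r 0) r'
  rw [hX.ray_eq_of_endpoint_eq (r := r) h0.symm
    (h.trans (GeodesicRay.endpoint_eq_iff.2 ⟨_, hr''⟩).symm)]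
  rw [h0]
  exact hr'' t

/-! ### The cone topology -/

theorem GeodesicRay.continuous_eval (t : ℝ≥0) : Continuous fun r : GeodesicRay X => r t :=
  (continuous_eval_const t).comp continuous_subtype_val

theorem GeodesicLine.continuous_eval (t : ℝ) : Continuous fun v : GeodesicLine X => v t :=
  (continuous_eval_const t).comp continuous_subtype_val

theorem GeodesicRay.continuous_endpoint :
    Continuous (GeodesicRay.endpoint : GeodesicRay X → Boundary X) :=
  continuous_quotient_mk'

/-- Rays that converge pointwise converge in the compact-open topology, by equicontinuity. -/
theorem GeodesicRay.tendsto_of_pointwise {ι : Type*} {F : Filter ι} {c : ι → GeodesicRay X}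
    {r : GeodesicRay X} (h : ∀ t, Tendsto (fun i => c i t) F (𝓝 (r t))) :
    Tendsto c F (𝓝 r) := by
  refine tendsto_subtype_rng.2 ?_
  rw [ContinuousMap.tendsto_iff_tendstoLocallyUniformly,
    Metric.tendstoLocallyUniformly_iff]
  intro ε hε t
  refine ⟨Metric.ball t (ε / 3), Metric.ball_mem_nhds _ (by positivity), ?_⟩
  filter_upwards [Metric.tendsto_nhds.1 (h t) (ε / 3) (by positivity)] with i hi s hs
  have h1 := r.2.dist_eq s t
  have h2 := (c i).2.dist_eq t s
  rw [Metric.mem_ball] at hs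
  rw [dist_comm t s] at h2
  have h3 := dist_triangle4 (r s) (r t) (c i t) (c i s)
  rw [dist_comm (r t)] at h3
  change dist (r s) (c i s) < ε
  linarith

variable [ProperSpace X]

/-- The ray from `x` to the point `ξ` at infinity. -/
noncomputable def IsCAT0.rayFrom (hX : IsCAT0 X) (x : X) (ξ : Boundary X) : GeodesicRay X :=
  (hX.exists_ray_from x ξ).choose

theorem IsCAT0.rayFrom_zero (hX : IsCAT0 X) (x : X) (ξ : Boundary X) : hX.rayFrom x ξ 0 = x :=
  (hX.exists_ray_from x ξ).choose_spec.1

theorem IsCAT0.endpoint_rayFrom (hX : IsCAT0 X) (x : X) (ξ : Boundary X) :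
    (hX.rayFrom x ξ).endpoint = ξ :=
  (hX.exists_ray_from x ξ).choose_spec.2

/-- The points of the ray from `x` to `ξ` depend continuously on `ξ`. The rays from `x` to the
endpoints of `r` and `r'` are close up to time `t` as soon as `r` and `r'` are within a bounded
distance of each other at a much larger time. -/
theorem IsCAT0.continuous_rayFrom (hX : IsCAT0 X) (x : X) (t : ℝ≥0) :
    Continuous fun ξ : Boundary X => hX.rayFrom x ξ t := by
  have hcont : Continuous fun r : GeodesicRay X => hX.rayFrom x r.endpoint t := by
    rw [continuous_iff_continuousAt]
    intro r
    rw [ContinuousAt, Metric.tendsto_nhds]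
    intro ε hε
    set D := dist x (r 0)
    have hlim : Tendsto (fun T : ℝ≥0 => t * (4 * D + 3) / (T : ℝ)) atTop (𝓝 0) :=
      tendsto_const_nhds.div_atTop (NNReal.tendsto_coe_atTop.2 tendsto_id)
    obtain ⟨T, hT, htT, hT0⟩ := ((hlim.eventually (gt_mem_nhds hε)).and
      ((eventually_ge_atTop t).and (eventually_gt_atTop 0))).exists
    have hT0' : (0 : ℝ) < T := hT0
    filter_upwards [Metric.tendsto_nhds.1 ((GeodesicRay.continuous_eval T).tendsto r) 1 one_pos,
      Metric.tendsto_nhds.1 ((GeodesicRay.continuous_eval 0).tendsto r) (1 / 2) (by norm_num)]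
      with r' h1 h2
    refine lt_of_le_of_lt ?_ hT
    rw [le_div_iff₀ hT0']
    refine (hX.dist_ray_mul_le (by simp only [hX.rayFrom_zero]) htT).trans
      (mul_le_mul_of_nonneg_left ?_ t.2)
    have h3 := hX.dist_le_of_endpoint_eq (hX.endpoint_rayFrom x r'.endpoint) T
    have h4 := hX.dist_le_of_endpoint_eq (hX.endpoint_rayFrom x r.endpoint) T
    rw [hX.rayFrom_zero] at h3 h4
    have h5 := dist_triangle4 (hX.rayFrom x r'.endpoint T) (r' T) (r T) (hX.rayFrom x r.endpoint T)
    rw [dist_comm (r T)] at h5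
    have h6 := dist_triangle_right x (r' 0) (r 0)
    linarith
  exact continuous_coinduced_dom.2 hcont

/-- Convergence of origins and endpoints implies pointwise convergence of rays. -/
theorem IsCAT0.tendsto_ray (hX : IsCAT0 X) {ι : Type*} {F : Filter ι} {c : ι → GeodesicRay X}
    {r : GeodesicRay X} (h0 : Tendsto (fun i => c i 0) F (𝓝 (r 0)))
    (h : Tendsto (fun i => (c i).endpoint) F (𝓝 r.endpoint)) (t : ℝ≥0) :
    Tendsto (fun i => c i t) F (𝓝 (r t)) := by
  have h1 := ((hX.continuous_rayFrom (r 0) t).tendsto _).comp h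
  rw [hX.ray_eq_of_endpoint_eq (hX.rayFrom_zero _ _) (hX.endpoint_rayFrom _ _)] at h1
  refine h1.congr_dist ?_
  have h2 : Tendsto (fun i => 2 * dist (r 0) (c i 0)) F (𝓝 0) := by
    simpa using ((tendsto_const_nhds (x := r 0)).dist h0).const_mul 2
  refine squeeze_zero (fun _ => dist_nonneg) (fun i => ?_) h2
  have h3 := hX.dist_le_of_endpoint_eq (hX.endpoint_rayFrom (r 0) (c i).endpoint) t
  rwa [hX.rayFrom_zero] at h3

end Rays

/-! ### Upper bounds for the angular metric and the Tits metric -/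

section TitsBounds

variable {X : Type*} [MetricSpace X]

theorem comparisonAngle_le_iff_chord {x y z : X} {T φ : ℝ} (hT : 0 < T) (hy : dist x y = T)
    (hz : dist x z = T) (hφ : φ ∈ Icc 0 Real.pi) :
    comparisonAngle x y z ≤ φ ↔ dist y z ≤ 2 * Real.sin (φ / 2) * T := by
  have hcos := cos_comparisonAngle (x := x) (y := y) (z := z) (dist_pos.1 (by rwa [hy]))
    (dist_pos.1 (by rwa [hz]))
  rw [hy, hz] at hcos
  have hm := comparisonAngle_mem x y z
  have hs : 0 ≤ Real.sin (φ / 2) :=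
    Real.sin_nonneg_of_nonneg_of_le_pi (by linarith [hφ.1]) (by linarith [hφ.2, Real.pi_pos])
  have hφ2 : Real.cos φ = 1 - 2 * Real.sin (φ / 2) ^ 2 := by
    rw [← Real.cos_two_mul_eq_one_sub, mul_div_cancel₀ _ two_ne_zero]
  rw [← Real.strictAntiOn_cos.le_iff_ge hφ hm, ← sq_le_sq₀ dist_nonneg (by positivity), hφ2,
    ← mul_le_mul_iff_of_pos_left (show 0 < 2 * T * T by positivity), hcos]
  constructor <;> intro h <;> linarith

/-- The angle between two points at infinity is controlled by the linear rate at which any pair of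
rays from a common origin diverges: moving the origin changes distances by a bounded amount, and
comparison angles are nondecreasing along the rays. -/
theorem IsCAT0.angle_le (hX : IsCAT0 X) {r r' : GeodesicRay X} {φ : ℝ} (hφ : φ ∈ Icc 0 Real.pi)
    (h : ∀ t : ℝ≥0, dist (r t) (r' t) ≤ 2 * Real.sin (φ / 2) * t) :
    angle r.endpoint r'.endpoint ≤ φ := by
  refine Real.sSup_le ?_ hφ.1
  rintro _ ⟨q, q', h0, hq, hq', rfl⟩
  obtain ⟨C, hC⟩ := GeodesicRay.endpoint_eq_iff.1 hq
  obtain ⟨C', hC'⟩ := GeodesicRay.endpoint_eq_iff.1 hq'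
  have hle : ∀ a b : ℝ≥0, 0 < a → 0 < b → comparisonAngle (q 0) (q a) (q' b) ≤ φ := by
    intro a b ha hb
    have hlim : Tendsto (fun T : ℝ≥0 =>
        Real.arccos (1 - (2 * Real.sin (φ / 2) + (C + C') / T) ^ 2 / 2)) atTop (𝓝 φ) := by
      have h1 : Tendsto (fun T : ℝ≥0 => (C + C') / (T : ℝ)) atTop (𝓝 0) :=
        tendsto_const_nhds.div_atTop (NNReal.tendsto_coe_atTop.2 tendsto_id)
      have h2 := (Real.continuous_arccos.tendsto _).comp
        ((((h1.const_add (2 * Real.sin (φ / 2))).pow 2).div_const 2).const_sub 1)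
      have h3 : 1 - (2 * Real.sin (φ / 2) + 0) ^ 2 / 2 = Real.cos φ := by
        rw [show Real.cos φ = 1 - 2 * Real.sin (φ / 2) ^ 2 by
          rw [← Real.cos_two_mul_eq_one_sub, mul_div_cancel₀ _ two_ne_zero]]
        ring
      rw [h3, Real.arccos_cos hφ.1 hφ.2] at h2
      exact h2
    refine ge_of_tendsto hlim ?_
    filter_upwards [eventually_ge_atTop a, eventually_ge_atTop b] with T haT hbT
    have hT : (0 : ℝ) < T := lt_of_lt_of_le ha haT
    have d1 := q.dist_zero_left T
    have d2 := q'.dist_zero_left T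
    rw [← h0] at d2
    have hv := q'.isGeodesicSegment T
    rw [← h0] at hv
    have hmono := hX.comparisonAngle_le (q.isGeodesicSegment T) hv (s := a) (t := b) ha
      (by rw [d1]; exact haT) hb (by rw [d2]; exact hbT)
    simp only [Real.toNNReal_coe] at hmono
    refine hmono.trans ?_
    unfold comparisonAngle
    rw [d1, d2]
    apply Real.arccos_le_arccos
    have h4 : dist (q T) (q' T) ≤ (2 * Real.sin (φ / 2) + (C + C') / T) * T := by
      rw [add_mul, div_mul_cancel₀ _ hT.ne']
      have h5 := dist_triangle4 (q T) (r T) (r' T) (q' T)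
      rw [dist_comm (r' T)] at h5
      linarith [hC T, hC' T, h T]
    have h6 := pow_le_pow_left₀ dist_nonneg h4 2
    rw [le_div_iff₀ (by positivity)]
    rw [mul_pow] at h6
    linarith
  refine limsup_le_of_le ?_ ?_
  · exact (isBoundedUnder_of ⟨0, fun p => (comparisonAngle_mem _ _ _).1⟩ :
      IsBoundedUnder (· ≥ ·) _ _).isCoboundedUnder_le
  · filter_upwards [prod_mem_prod (self_mem_nhdsWithin (s := Ioi (0 : ℝ≥0)) (a := 0))
      (self_mem_nhdsWithin (s := Ioi (0 : ℝ≥0)) (a := 0))] with p hp using hle _ _ hp.1 hp.2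

theorem titsDist_le_of_lipschitz {c : ℝ → Boundary X} {θ : ℝ} (hθ : 0 ≤ θ)
    (h : ∀ s ∈ Icc (0 : ℝ) 1, ∀ t ∈ Icc (0 : ℝ) 1, angle (c s) (c t) ≤ |s - t| * θ) :
    titsDist (c 0) (c 1) ≤ ENNReal.ofReal θ := by
  refine iInf₂_le_of_le c ⟨?_, rfl, rfl⟩ (iSup_le ?_)
  · intro t ht ε hε
    refine ⟨ε / (θ + 1), by positivity, fun s hs hst => ?_⟩
    rw [lt_div_iff₀ (by positivity)] at hst
    refine (h s hs t ht).trans_lt ?_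
    nlinarith [abs_nonneg (s - t)]
  · rintro ⟨n, u, hu, huI⟩
    have hstep : ∀ i, 0 ≤ (u (i + 1) - u i) * θ := fun i =>
      mul_nonneg (sub_nonneg.2 (hu i.le_succ)) hθ
    calc ∑ i ∈ Finset.range n, ENNReal.ofReal (angle (c (u i)) (c (u (i + 1))))
        ≤ ∑ i ∈ Finset.range n, ENNReal.ofReal ((u (i + 1) - u i) * θ) := by
          refine Finset.sum_le_sum fun i _ => ENNReal.ofReal_le_ofReal ?_
          refine (h _ (huI i) _ (huI (i + 1))).trans_eq ?_
          rw [abs_sub_comm, abs_of_nonneg (sub_nonneg.2 (hu i.le_succ))]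
      _ = ENNReal.ofReal ((u n - u 0) * θ) := by
          rw [← ENNReal.ofReal_sum_of_nonneg fun i _ => hstep i, ← Finset.sum_mul,
            Finset.sum_range_sub]
      _ ≤ ENNReal.ofReal θ := by
          refine ENNReal.ofReal_le_ofReal (mul_le_of_le_one_left hθ ?_)
          linarith [(huI n).2, (huI 0).1]

/-- Points on the segment from `y` to `z` that divide the comparison angle at `x` evenly. The
segment keeps away from `x`, so that the comparison angle with `y` is continuous along it. -/
theorem IsCAT0.exists_equiangular (hX : IsCAT0 X) {x y z : X} {T θ : ℝ} (hT : 0 < T)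
    (hy : dist x y = T) (hz : dist x z = T) (hθ : 0 ≤ θ) (hθπ : θ < Real.pi)
    (h : dist y z ≤ 2 * Real.sin (θ / 2) * T) :
    ∃ q : ℝ → X, q 0 = y ∧ q 1 = z ∧
      (∀ s ∈ Icc (0 : ℝ) 1, T * (1 - Real.sin (θ / 2)) ≤ dist x (q s)) ∧
      ∀ s ∈ Icc (0 : ℝ) 1, ∀ t ∈ Icc (0 : ℝ) 1, comparisonAngle x (q s) (q t) ≤ |s - t| * θ := by
  obtain ⟨p, hp⟩ := hX.exists_segment y z
  have hxy : x ≠ y := dist_pos.1 (by rwa [hy])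
  have hheight : ∀ u ∈ Icc 0 (dist y z), T * (1 - Real.sin (θ / 2)) ≤ dist x (p u) := by
    intro u hu
    have h1 := dist_triangle_right x y (p u)
    have h2 := dist_triangle x (p u) z
    rw [hp.dist_left hu, hy] at h1
    rw [hp.dist_right hu, hz] at h2
    linarith
  have hsin : Real.sin (θ / 2) < 1 := by
    rw [← Real.sin_pi_div_two]
    exact Real.sin_lt_sin_of_lt_of_le_pi_div_two (by linarith [Real.pi_pos]) le_rfl (by linarith)
  have hne : ∀ u ∈ Icc 0 (dist y z), x ≠ p u := fun u hu =>
    dist_pos.1 ((mul_pos hT (by linarith)).trans_le (hheight u hu))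
  set φ : ℝ → ℝ := fun u => comparisonAngle x y (p u) with hφ
  have hpc : ContinuousOn p (Icc 0 (dist y z)) := by
    refine LipschitzOnWith.continuousOn (K := 1) (LipschitzOnWith.of_dist_le_mul ?_)
    intro s hs t ht
    rw [hp.2.2 s hs t ht, Real.dist_eq, NNReal.coe_one, one_mul]
  have hφc : ContinuousOn φ (Icc 0 (dist y z)) := by
    have hd : ContinuousOn (fun u => dist x (p u)) (Icc 0 (dist y z)) :=
      continuous_dist.comp_continuousOn (continuousOn_const.prodMk hpc)
    have hd' : ContinuousOn (fun u => dist y (p u)) (Icc 0 (dist y z)) :=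
      continuous_dist.comp_continuousOn (continuousOn_const.prodMk hpc)
    refine Real.continuous_arccos.comp_continuousOn (ContinuousOn.div ?_ ?_ ?_)
    · exact (continuousOn_const.add (hd.pow 2)).sub (hd'.pow 2)
    · exact continuousOn_const.mul hd
    · intro u hu
      have := dist_pos.2 (hne u hu)
      have := dist_pos.2 hxy
      positivity
  have hdiv : ∀ u ∈ Icc 0 (dist y z), ∀ v ∈ Icc 0 (dist y z), u ≤ v →
      comparisonAngle x (p u) (p v) ≤ φ v - φ u := by
    intro u hu v hv huv
    have h1 := hX.comparisonAngle_add_le (hp.restrict hv) (t := u)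
      (by rw [hp.dist_left hv]; exact ⟨hu.1, huv⟩) hxy (hne u hu) (hne v hv)
    simp only [hφ]
    linarith
  have hdiv' : ∀ u ∈ Icc 0 (dist y z), ∀ v ∈ Icc 0 (dist y z),
      comparisonAngle x (p u) (p v) ≤ |φ u - φ v| := by
    intro u hu v hv
    rcases le_total u v with huv | huv
    · rw [abs_sub_comm]
      exact (hdiv u hu v hv huv).trans (le_abs_self _)
    · rw [comparisonAngle_comm]
      exact (hdiv v hv u hu huv).trans (le_abs_self _)
  have hφ0 : φ 0 = 0 := by simp only [hφ, hp.1, comparisonAngle_self hxy]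
  have hφL : φ (dist y z) = comparisonAngle x y z := by simp only [hφ, hp.2.1]
  have hm := comparisonAngle_mem x y z
  have hθT : comparisonAngle x y z ≤ θ :=
    (comparisonAngle_le_iff_chord hT hy hz ⟨hθ, hθπ.le⟩).2 h
  have hex : ∀ s ∈ Icc (0 : ℝ) 1, ∃ u ∈ Icc 0 (dist y z),
      φ u = s * comparisonAngle x y z ∧ (s = 0 → u = 0) ∧ (s = 1 → u = dist y z) := by
    intro s hs
    by_cases h0 : s = 0
    · exact ⟨0, ⟨le_rfl, dist_nonneg⟩, by rw [h0, hφ0, zero_mul], fun _ => rfl, by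
        rw [h0]; intro h; norm_num at h⟩
    by_cases h1 : s = 1
    · exact ⟨_, ⟨dist_nonneg, le_rfl⟩, by rw [h1, hφL, one_mul], fun h => absurd h h0, fun _ => rfl⟩
    obtain ⟨u, hu, hus⟩ := intermediate_value_Icc dist_nonneg hφc
      (show s * comparisonAngle x y z ∈ Icc (φ 0) (φ (dist y z)) by
        rw [hφ0, hφL]
        exact ⟨mul_nonneg hs.1 hm.1, mul_le_of_le_one_left hm.1 hs.2⟩)
    exact ⟨u, hu, hus, fun h => absurd h h0, fun h => absurd h h1⟩
  choose! u hu hus hu0 hu1 using hex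
  refine ⟨fun s => p (u s), ?_, ?_, fun s hs => hheight _ (hu s hs), fun s hs t ht => ?_⟩
  · simp only [hu0 0 ⟨le_rfl, zero_le_one⟩ rfl, hp.1]
  · simp only [hu1 1 ⟨zero_le_one, le_rfl⟩ rfl, hp.2.1]
  · refine (hdiv' _ (hu s hs) _ (hu t ht)).trans ?_
    rw [hus s hs, hus t ht, ← sub_mul, abs_mul, abs_of_nonneg hm.1]
    exact mul_le_mul_of_nonneg_left hθT (abs_nonneg _)

/-- If two rays from a common origin diverge at a linear rate that corresponds to an angle
`θ < π`, then the Tits distance of their endpoints is at most `θ`. A path that realizes this bound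
is an ultralimit of the segments between the points of the two rays, seen from the origin. -/
theorem IsCAT0.titsDist_le [ProperSpace X] (hX : IsCAT0 X) {r r' : GeodesicRay X} {θ : ℝ}
    (h0 : r 0 = r' 0) (hθ : 0 ≤ θ) (hθπ : θ < Real.pi)
    (h : ∀ t : ℝ≥0, dist (r t) (r' t) ≤ 2 * Real.sin (θ / 2) * t) :
    titsDist r.endpoint r'.endpoint ≤ ENNReal.ofReal θ := by
  have hsin : Real.sin (θ / 2) < 1 := by
    rw [← Real.sin_pi_div_two]
    exact Real.sin_lt_sin_of_lt_of_le_pi_div_two (by linarith [Real.pi_pos]) le_rfl (by linarith)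
  have hpos : ∀ n : ℕ, (0 : ℝ) < ((n : ℝ≥0) + 1 : ℝ≥0) := fun n => by positivity
  choose q hq0 hq1 hqh hqa using fun n : ℕ => hX.exists_equiangular (hpos n)
    (r.dist_zero_left (n + 1)) (by rw [h0, r'.dist_zero_left]) hθ hθπ (h (n + 1))
  choose u hu using fun (s : ℝ) (n : ℕ) => hX.exists_segment (r 0) (q n s)
  set F : Ultrafilter ℕ := Ultrafilter.of atTop
  have hF : (F : Filter ℕ) ≤ atTop := Ultrafilter.of_le _
  have hT : Tendsto (fun n : ℕ => (((n : ℝ≥0) + 1 : ℝ≥0) : ℝ)) atTop atTop := by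
    push_cast
    exact tendsto_atTop_add_const_right _ _ tendsto_natCast_atTop_atTop
  have hlen : ∀ s ∈ Icc (0 : ℝ) 1, Tendsto (fun n => dist (r 0) (q n s)) F atTop := fun s hs =>
    (tendsto_atTop_mono (fun n => hqh n s hs) (hT.atTop_mul_const (by linarith))).mono_left hF
  have hray : ∀ s ∈ Icc (0 : ℝ) 1, ∃ c : GeodesicRay X, c 0 = r 0 ∧
      ∀ t : ℝ≥0, Tendsto (fun n => u s n t) F (𝓝 (c t)) := fun s hs =>
    exists_ray_of_segments F (hu s) (hlen s hs)
  have : Nonempty (GeodesicRay X) := ⟨r⟩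
  choose! c hc0 hc using hray
  -- the segments to the endpoints `q n 0` and `q n 1` are initial parts of `r` and `r'`
  have hend : ∀ s ∈ Icc (0 : ℝ) 1, ∀ ρ : GeodesicRay X, ρ 0 = r 0 →
      (∀ n : ℕ, q n s = ρ (n + 1)) → c s = ρ := by
    intro s hs ρ hρ0 hρ
    ext t
    refine tendsto_nhds_unique (hc s hs t) (tendsto_const_nhds.congr' ?_)
    filter_upwards [hF (hT.eventually_ge_atTop t)] with n hn
    have h1 := hu s n
    rw [hρ n, ← hρ0] at h1
    have h2 := hX.segment_unique _ _ _ _ h1 (ρ.isGeodesicSegment (n + 1))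
      (show (t : ℝ) ∈ _ from ⟨t.coe_nonneg, by rw [ρ.dist_zero_left]; exact hn⟩)
    rw [h2, Real.toNNReal_coe]
  have e0 : c 0 = r := hend 0 ⟨le_rfl, zero_le_one⟩ r rfl hq0
  have e1 : c 1 = r' := hend 1 ⟨zero_le_one, le_rfl⟩ r' h0.symm hq1
  have hlip := titsDist_le_of_lipschitz (c := fun s => (c s).endpoint) hθ fun s hs t ht => by
    have hst : |s - t| ≤ 1 := abs_le.2 ⟨by linarith [hs.1, ht.2], by linarith [hs.2, ht.1]⟩
    have hmem : |s - t| * θ ∈ Icc 0 Real.pi :=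
      ⟨by positivity, (mul_le_of_le_one_left hθ hst).trans hθπ.le⟩
    refine hX.angle_le hmem fun a => ?_
    rcases eq_zero_or_pos a with rfl | ha
    · simp [hc0 s hs, hc0 t ht]
    have ha' : (0 : ℝ) < a := ha
    refine le_of_tendsto ((hc s hs a).dist (hc t ht a)) ?_
    filter_upwards [(hlen s hs).eventually_ge_atTop a, (hlen t ht).eventually_ge_atTop a]
      with n h1 h2
    rw [← comparisonAngle_le_iff_chord ha' ((hu s n).dist_left ⟨ha'.le, h1⟩)
      ((hu t n).dist_left ⟨ha'.le, h2⟩) hmem]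
    exact (hX.comparisonAngle_le (hu s n) (hu t n) ha' h1 ha' h2).trans (hqa n s hs t ht)
  simp only [e0, e1] at hlip
  exact hlip

end TitsBounds

/-! ### Limits of isometries acting on the boundary -/

section Convergence

variable {X : Type*} [MetricSpace X]

theorem chord_sq_eq {x y z : X} {T : ℝ} (hT : 0 < T) (hy : dist x y = T) (hz : dist x z = T) :
    (dist y z / T) ^ 2 = 2 - 2 * Real.cos (comparisonAngle x y z) := by
  have h := cos_comparisonAngle (x := x) (y := y) (z := z) (dist_pos.1 (by rwa [hy]))
    (dist_pos.1 (by rwa [hz]))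
  rw [hy, hz] at h
  rw [div_pow, div_eq_iff (by positivity)]
  linarith

/-- In a triangle with one vertex at infinity, the angles at the two other vertices add up to at
most `π`. The angles enter through the chords that they cut out at the distances `s` and `r`, and
a sum of angles at most `π` means a sum of squares of normalized chords at most `4`. -/
theorem IsCAT0.chord_sq_add_chord_sq_le [ProperSpace X] (hX : IsCAT0 X) {c d : GeodesicRay X}
    (hcd : c.endpoint = d.endpoint) {p : ℝ → X} (hp : IsGeodesicSegment p (c 0) (d 0))
    {s r : ℝ≥0} (hs : 0 < s) (hs' : s ≤ dist (c 0) (d 0)) (hr : 0 < r)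
    (hr' : r ≤ dist (c 0) (d 0)) :
    (dist (p s) (c s) / s) ^ 2 + (dist (p (dist (c 0) (d 0) - r)) (d r) / r) ^ 2 ≤ 4 := by
  have hs0 : (0 : ℝ) < s := hs
  have hr0 : (0 : ℝ) < r := hr
  obtain ⟨d', h0, hd', F, u, hF, hu, hlim⟩ := hX.exists_asymptotic_ray (d 0) c
  obtain rfl : d = d' := hX.ray_eq_of_endpoint_eq h0.symm
    (hcd.symm.trans (GeodesicRay.endpoint_eq_iff.2 ⟨_, hd'⟩).symm)
  refine le_of_tendsto (((((tendsto_const_nhds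
    (x := p (dist (c 0) (d 0) - r))).dist (hlim r)).div_const (r : ℝ)).pow 2).const_add _) ?_
  have hlen : Tendsto (fun T : ℝ≥0 => dist (d 0) (c T)) atTop atTop := by
    refine tendsto_atTop_mono (f := fun T : ℝ≥0 => (T : ℝ) + -dist (c 0) (d 0)) (fun T => ?_)
      (tendsto_atTop_add_const_right _ _ (NNReal.tendsto_coe_atTop.2 tendsto_id))
    have h := dist_triangle (c 0) (d 0) (c T)
    rw [c.dist_zero_left] at h
    linarith
  filter_upwards [hF (hlen.eventually_ge_atTop r), hF (eventually_ge_atTop s)] with T h1 h2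
  have h2' : (s : ℝ) ≤ T := h2
  have hcT := c.dist_zero_left T
  have m1 := hX.comparisonAngle_le hp (c.isGeodesicSegment T) hs0 hs' hs0 (by rw [hcT]; exact h2)
  have m2 := hX.comparisonAngle_le hp.symm (hu T) hr0 (by rwa [dist_comm]) hr0 h1
  simp only [Real.toNNReal_coe] at m1
  have hsum := cos_comparisonAngle_add_nonneg (x := c 0) (y := d 0) (z := c T)
    (dist_pos.1 (hs0.trans_le hs')) (dist_pos.1 (by rw [hcT]; exact hs0.trans_le h2))
    (dist_pos.1 (hr0.trans_le h1))
  rw [chord_sq_eq hs0 (hp.dist_left ⟨hs0.le, hs'⟩) (c.dist_zero_left s),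
    chord_sq_eq (x := d 0) hr0 (hp.symm.dist_left ⟨hr0.le, by rwa [dist_comm]⟩)
      ((hu T).dist_left ⟨hr0.le, h1⟩)]
  have n1 := Real.cos_le_cos_of_nonneg_of_le_pi (comparisonAngle_mem _ _ _).1
    (comparisonAngle_mem _ _ _).2 m1
  have n2 := Real.cos_le_cos_of_nonneg_of_le_pi (comparisonAngle_mem _ _ _).1
    (comparisonAngle_mem _ _ _).2 m2
  linarith

/-- The rays `c` from `w 0` and `e` from `v 0` make angles with the geodesics `w`, run backwards,
and `v` that add up to at most `π`. The angles are measured at infinity, by normalized chords. -/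
def AnglesAddLePi (w v : GeodesicLine X) (c e : GeodesicRay X) : Prop :=
  ∀ s r : ℝ≥0, 0 < s → 0 < r → (dist (w (-s)) (c s) / s) ^ 2 + (dist (v r) (e r) / r) ^ 2 ≤ 4

/-- Either the second angle vanishes, since the first one is `π`, or the first angle `α` is less
than `π`, in which case it bounds the Tits distance. -/
theorem AnglesAddLePi.dichotomy [ProperSpace X] (hX : IsCAT0 X) {w v : GeodesicLine X}
    {c e : GeodesicRay X} (h : AnglesAddLePi w v c e) (hc : c 0 = w 0) (he : e 0 = v 0) :
    e.endpoint = v.plus ∨ ∃ α : ℝ, 0 ≤ α ∧ α < Real.pi ∧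
      titsDist w.minus c.endpoint ≤ ENNReal.ofReal α ∧
      ∀ t : ℝ≥0, dist (v t) (e t) ≤ 2 * Real.sin ((Real.pi - α) / 2) * t := by
  -- the supremum `l` of the normalized chords is `2 sin (α / 2)`; the junk value at `s = 0` is `0`
  set f : ℝ≥0 → ℝ := fun s => dist (w (-s)) (c s) / s with hf
  have hf0 : ∀ s, 0 ≤ f s := fun s => div_nonneg dist_nonneg s.2
  have hf2 : ∀ s, f s ≤ 2 := by
    intro s
    refine div_le_of_le_mul₀ s.2 zero_le_two ?_
    have h1 := w.backwardRay.dist_zero_left s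
    have h2 := c.dist_zero_left s
    have h3 := dist_triangle_left (w (-s)) (c s) (c 0)
    have h4 : w.backwardRay 0 = w 0 := by simp [GeodesicLine.backwardRay]
    rw [h4, ← hc] at h1
    change dist (c 0) (w (-s)) = s at h1
    linarith
  have hbdd : BddAbove (range f) := ⟨2, by rintro _ ⟨s, rfl⟩; exact hf2 s⟩
  set l := ⨆ s, f s
  have hfl : ∀ s, f s ≤ l := fun s => le_ciSup hbdd s
  have hl0 : 0 ≤ l := (hf0 0).trans (hfl 0)
  have hl2 : l ≤ 2 := ciSup_le hf2
  have key : ∀ r : ℝ≥0, 0 < r → (dist (v r) (e r) / r) ^ 2 + l ^ 2 ≤ 4 := by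
    intro r hr
    have h4 : (dist (v r) (e r) / r) ^ 2 ≤ 4 := by
      have := h 1 r one_pos hr
      have := sq_nonneg (dist (w (-(1 : ℝ≥0))) (c 1) / (1 : ℝ≥0))
      linarith
    have hle : l ≤ √(4 - (dist (v r) (e r) / r) ^ 2) := by
      refine ciSup_le fun s => Real.le_sqrt_of_sq_le ?_
      rcases eq_zero_or_pos s with rfl | hs
      · simpa [hf] using h4
      · have := h s r hs hr
        simp only [hf]
        linarith
    have := (Real.le_sqrt hl0 (by linarith)).1 hle
    linarith
  rcases hl2.lt_or_eq with hlt | heq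
  · right
    have hsin : Real.sin (Real.arcsin (l / 2)) = l / 2 :=
      Real.sin_arcsin (by linarith) (by linarith)
    refine ⟨2 * Real.arcsin (l / 2), mul_nonneg zero_le_two (Real.arcsin_nonneg.2 (by linarith)),
      ?_, ?_, fun t => ?_⟩
    · have := Real.arcsin_lt_pi_div_two.2 (show l / 2 < 1 by linarith)
      linarith
    · refine hX.titsDist_le (r := w.backwardRay) (by simp [GeodesicLine.backwardRay, hc])
        (mul_nonneg zero_le_two (Real.arcsin_nonneg.2 (by linarith))) ?_ fun t => ?_
      · have := Real.arcsin_lt_pi_div_two.2 (show l / 2 < 1 by linarith)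
        linarith
      · rw [mul_div_cancel_left₀ _ two_ne_zero, hsin, mul_div_cancel₀ _ two_ne_zero]
        change dist (w (-t)) (c t) ≤ l * t
        rcases eq_zero_or_pos t with rfl | ht
        · simp [hc]
        · exact (div_le_iff₀ (by exact_mod_cast ht)).1 (hfl t)
    · rw [sub_div, mul_div_cancel_left₀ _ two_ne_zero, Real.sin_pi_div_two_sub]
      rcases eq_zero_or_pos t with rfl | ht
      · simp [he]
      have ht' : (0 : ℝ) < t := ht
      rw [← div_le_iff₀ ht']
      refine le_of_sq_le_sq ?_ (mul_nonneg zero_le_two (Real.cos_arcsin_nonneg _))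
      have h1 := key t ht
      have h2 := Real.sin_sq_add_cos_sq (Real.arcsin (l / 2))
      rw [hsin] at h2
      rw [mul_pow]
      linarith
  -- if `l = 2`, then all chords between `v` and `e` vanish
  · left
    have : e = v.forwardRay := by
      ext t
      change e t = v t
      rcases eq_zero_or_pos t with rfl | ht
      · simpa using he
      have ht' : (0 : ℝ) < t := ht
      have h1 := key t ht
      rw [heq] at h1
      have h2 : (dist (v t) (e t) / t) ^ 2 = 0 :=
        le_antisymm (by linarith) (sq_nonneg _)
      have h3 := (div_eq_zero_iff.1 (pow_eq_zero_iff two_ne_zero |>.1 h2)).resolve_right ht'.ne'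
      exact (dist_eq_zero.1 h3).symm
    rw [this]
    rfl

variable [ProperSpace X] {Γ : Type*} [Group Γ] [MulAction Γ X] [IsIsometricSMul Γ X]

/-- If `γ` moves `w (-t)` to `v 0` along the flow, then the angles at `w 0` and `v 0` of the
triangle with third vertex `ξ` at infinity, respectively of its image under `γ`, add up to at most
`π`, as far as they are visible at scales up to `t`. -/
theorem IsCAT0.chord_sq_add_chord_sq_flow_le (hX : IsCAT0 X) {w : GeodesicLine X} {t : ℝ} (γ : Γ)
    (ξ : Boundary X) {s r : ℝ≥0} (hs : 0 < s) (hst : s ≤ t) (hr : 0 < r) (hrt : r ≤ t) :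
    (dist (w (-s)) (hX.rayFrom (w 0) ξ s) / s) ^ 2 +
      (dist ((γ • geodesicFlow (-t) w : GeodesicLine X) r)
        ((γ • hX.rayFrom (w (-t)) ξ : GeodesicRay X) r) / r) ^ 2 ≤ 4 := by
  have ht : 0 ≤ t := s.coe_nonneg.trans hst
  have hdist : dist (w 0) (w (-t)) = t := by
    rw [w.2.dist_eq, Real.dist_eq, sub_neg_eq_add, zero_add, abs_of_nonneg ht]
  have hp : IsGeodesicSegment (fun a => w (-a)) (w 0) (w (-t)) := by
    refine ⟨by simp, by rw [hdist], fun a _ b _ => ?_⟩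
    rw [w.2.dist_eq, Real.dist_eq, abs_sub_comm]
    congr 1
    ring
  have h := hX.chord_sq_add_chord_sq_le
    ((hX.endpoint_rayFrom (w 0) ξ).trans (hX.endpoint_rayFrom (w (-t)) ξ).symm)
    (p := fun a => w (-a)) (by rwa [hX.rayFrom_zero, hX.rayFrom_zero]) hs
    (by rwa [hX.rayFrom_zero, hX.rayFrom_zero, hdist]) hr
    (by rwa [hX.rayFrom_zero, hX.rayFrom_zero, hdist])
  rw [hX.rayFrom_zero, hX.rayFrom_zero, hdist] at h
  have e : dist ((γ • geodesicFlow (-t) w : GeodesicLine X) r)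
      ((γ • hX.rayFrom (w (-t)) ξ : GeodesicRay X) r) =
      dist (w (-(t - r))) (hX.rayFrom (w (-t)) ξ r) := by
    rw [neg_sub, sub_eq_neg_add]
    exact dist_smul γ _ _
  rw [e]
  exact h

/-- Reduction of the claim on translates of `K` to a statement about single geodesics and rays. If
`γ g⁻ᵗ w = v` with `v` and `w` in a compact set and `t → ∞`, then every limit of points `γ ξ` with
`ξ ∈ K` is the endpoint of a ray `e` whose angle with the limit of the `v` is at most `π` minus the
angle between the limit of the `ξ` and the backward endpoint of the limit of the `w`. So it is
enough that some `U i` contains all such limits. -/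
theorem IsCAT0.exists_forall_smul_subset (hX : IsCAT0 X) {V : Set (GeodesicLine X)}
    (hV : IsCompact V) {ι : Type*} {U : ι → Set (Boundary X)} (hU : ∀ i, IsOpen (U i))
    {K : Set (Boundary X)} (hK : IsCompact K)
    (H : ∀ v ∈ V, ∃ i, ∀ w ∈ V, ∀ c e : GeodesicRay X, c 0 = w 0 → e 0 = v 0 → c.endpoint ∈ K →
      AnglesAddLePi w v c e → e.endpoint ∈ U i) :
    ∃ t₀ : ℝ, 0 ≤ t₀ ∧ ∀ t ≥ t₀, ∀ γ : Γ,
      (V ∩ (fun v => γ • geodesicFlow (-t) v) '' V).Nonempty →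
        ∃ i, (fun ξ => γ • ξ) '' K ⊆ U i := by
  by_contra! hcon
  have hbad : ∀ n : ℕ, ∃ (t : ℝ) (γ : Γ) (w : GeodesicLine X), (n : ℝ) ≤ t ∧ w ∈ V ∧
      γ • geodesicFlow (-t) w ∈ V ∧ ∀ i, ∃ ξ ∈ K, γ • ξ ∉ U i := by
    intro n
    obtain ⟨t, ht, γ, ⟨_, hv, w, hw, rfl⟩, hi⟩ := hcon n n.cast_nonneg
    refine ⟨t, γ, w, ht, hw, hv, fun i => ?_⟩
    obtain ⟨_, ⟨ξ, hξ, rfl⟩, hξU⟩ := not_subset.1 (hi i)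
    exact ⟨ξ, hξ, hξU⟩
  choose t γ w ht hw hv hξ using hbad
  set F : Ultrafilter ℕ := Ultrafilter.of atTop
  have hF : (F : Filter ℕ) ≤ atTop := Ultrafilter.of_le _
  have htF : Tendsto t F atTop :=
    (tendsto_atTop_mono ht tendsto_natCast_atTop_atTop).mono_left hF
  obtain ⟨w₀, hw₀, hwlim⟩ := hV.ultrafilter_le_nhds (F.map w)
    (le_principal_iff.2 (Eventually.of_forall hw : ∀ᶠ n in (F : Filter ℕ), w n ∈ V))
  obtain ⟨v₀, hv₀, hvlim⟩ := hV.ultrafilter_le_nhds (F.map fun n => γ n • geodesicFlow (-t n) (w n))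
    (le_principal_iff.2 (Eventually.of_forall hv :
      ∀ᶠ n in (F : Filter ℕ), γ n • geodesicFlow (-t n) (w n) ∈ V))
  replace hwlim : Tendsto w F (𝓝 w₀) := hwlim
  replace hvlim : Tendsto (fun n => γ n • geodesicFlow (-t n) (w n)) F (𝓝 v₀) := hvlim
  obtain ⟨i, hi⟩ := H v₀ hv₀
  choose ξ hξK hξU using fun n => hξ n i
  obtain ⟨ξ₀, hξ₀, hξlim⟩ := hK.ultrafilter_le_nhds (F.map ξ)
    (le_principal_iff.2 (Eventually.of_forall hξK : ∀ᶠ n in (F : Filter ℕ), ξ n ∈ K))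
  replace hξlim : Tendsto ξ F (𝓝 ξ₀) := hξlim
  have hweval : ∀ s : ℝ, Tendsto (fun n => w n s) F (𝓝 (w₀ s)) := fun s =>
    ((GeodesicLine.continuous_eval s).tendsto w₀).comp hwlim
  have hveval : ∀ s : ℝ, Tendsto (fun n => (γ n • geodesicFlow (-t n) (w n) : GeodesicLine X) s) F
      (𝓝 (v₀ s)) := fun s => ((GeodesicLine.continuous_eval s).tendsto v₀).comp hvlim
  set e : ℕ → GeodesicRay X := fun n => γ n • hX.rayFrom (w n (-t n)) (ξ n)
  have he0 : ∀ n, e n 0 = (γ n • geodesicFlow (-t n) (w n) : GeodesicLine X) 0 := by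
    intro n
    change γ n • hX.rayFrom (w n (-t n)) (ξ n) 0 = γ n • w n (-t n + 0)
    rw [hX.rayFrom_zero, add_zero]
  have heend : ∀ n, (e n).endpoint = γ n • ξ n := by
    intro n
    conv_rhs => rw [← hX.endpoint_rayFrom (w n (-t n)) (ξ n)]
    rfl
  obtain ⟨e₀, he₀, helim⟩ := exists_ray_of_ultrafilter F (fun n a => e n a.toNNReal) (x := v₀ 0)
    (by simpa only [Real.toNNReal_zero, he0] using hveval 0)
    (fun a b ha hb => Eventually.of_forall fun n => by
      rw [(e n).dist_eq, Real.coe_toNNReal _ ha, Real.coe_toNNReal _ hb])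
  simp only [Real.toNNReal_coe] at helim
  have hclim := fun s : ℝ≥0 => hX.tendsto_ray (c := fun n => hX.rayFrom (w n 0) (ξ n))
    (r := hX.rayFrom (w₀ 0) ξ₀) (F := F) (by simpa only [hX.rayFrom_zero] using hweval 0)
    (by simpa only [hX.endpoint_rayFrom] using hξlim) s
  have hangles : AnglesAddLePi w₀ v₀ (hX.rayFrom (w₀ 0) ξ₀) e₀ := by
    intro s r hs hr
    refine le_of_tendsto (((((hweval (-s)).dist (hclim s)).div_const (s : ℝ)).pow 2).add
      ((((hveval r).dist (helim r)).div_const (r : ℝ)).pow 2)) ?_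
    filter_upwards [htF.eventually_ge_atTop s, htF.eventually_ge_atTop r] with n h1 h2
    exact hX.chord_sq_add_chord_sq_flow_le (γ n) (ξ n) hs h1 hr h2
  have hmem := hi w₀ hw₀ _ e₀ (hX.rayFrom_zero _ _) he₀
    (by rwa [hX.endpoint_rayFrom]) hangles
  have hend : Tendsto (fun n => (e n).endpoint) F (𝓝 e₀.endpoint) :=
    (GeodesicRay.continuous_endpoint.tendsto e₀).comp (GeodesicRay.tendsto_of_pointwise helim)
  obtain ⟨n, hn⟩ := (hend.eventually ((hU i).mem_nhds hmem)).exists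
  rw [heend] at hn
  exact hξU n hn

end Convergence

end Cat0

theorem mainTheorem8 {X : Type*} [MetricSpace X] [ProperSpace X] (hX : Cat0.IsCAT0 X)
    {Γ : Type*} [Group Γ] [MulAction Γ X] [IsIsometricSMul Γ X] [ProperlyDiscontinuousSMul Γ X]
    (V : Set (Cat0.GeodesicLine X)) (hV : IsCompact V)
    {ι : Type*} (U : ι → Set (Cat0.Boundary X)) (hUopen : ∀ i, IsOpen (U i))
    (hUcover : Cat0.GeodesicLine.plus '' V ⊆ ⋃ i, U i)
    (K : Set (Cat0.Boundary X)) (hK : IsCompact K) :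
    (∀ c ∈ Icc 0 Real.pi,
      (∀ ξ ∈ Cat0.GeodesicLine.plus '' V, ∃ i, Cat0.closedTitsBall ξ c ⊆ U i) →
      ENNReal.ofReal (Real.pi - c) < Cat0.titsSetDist (Cat0.GeodesicLine.minus '' V) K →
      ∃ t₀ : ℝ, 0 ≤ t₀ ∧ ∀ t ≥ t₀, ∀ γ : Γ,
        (V ∩ (fun v => γ • Cat0.geodesicFlow (-t) v) '' V).Nonempty →
          ∃ i, (fun ξ => γ • ξ) '' K ⊆ U i) ∧
    (ENNReal.ofReal Real.pi < Cat0.titsSetDist (Cat0.GeodesicLine.minus '' V) K →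
      ∃ t₀ : ℝ, 0 ≤ t₀ ∧ ∀ t ≥ t₀, ∀ γ : Γ,
        (V ∩ (fun v => γ • Cat0.geodesicFlow (-t) v) '' V).Nonempty →
          ∃ i, (fun ξ => γ • ξ) '' K ⊆ U i) := by
  have hlt : ∀ {a b : ℝ} {w : Cat0.GeodesicLine X} {c : Cat0.GeodesicRay X}, w ∈ V →
      c.endpoint ∈ K → ENNReal.ofReal a < Cat0.titsSetDist (Cat0.GeodesicLine.minus '' V) K →
      Cat0.titsDist w.minus c.endpoint ≤ ENNReal.ofReal b → a < b := by
    intro a b w c hw hc ha hb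
    by_contra hab
    exact absurd ((ha.trans_le (iInf₂_le_of_le _ (mem_image_of_mem _ hw)
      (iInf₂_le _ hc))).trans_le hb) (not_lt.2 (ENNReal.ofReal_le_ofReal (not_lt.1 hab)))
  refine ⟨fun a ha hball hdist => ?_, fun hdist => ?_⟩
  · refine hX.exists_forall_smul_subset hV hUopen hK fun v hv => ?_
    obtain ⟨i, hi⟩ := hball _ (mem_image_of_mem _ hv)
    refine ⟨i, fun w hw c e hc he hcK hangles => hi ?_⟩
    rcases hangles.dichotomy hX hc he with h | ⟨α, hα, hαπ, hle, hchord⟩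
    · rw [h]
      refine (hX.titsDist_le (r := v.forwardRay) (r' := v.forwardRay) rfl le_rfl Real.pi_pos
        fun t => ?_).trans (ENNReal.ofReal_le_ofReal ha.1)
      simp
    · have hlt' := hlt hw hcK hdist hle
      refine (hX.titsDist_le (r := v.forwardRay) (r' := e) (θ := Real.pi - α) ?_ (by linarith)
        (by linarith [ha.2]) hchord).trans (ENNReal.ofReal_le_ofReal (by linarith))
      rw [he]
      simp [Cat0.GeodesicLine.forwardRay]
  · refine hX.exists_forall_smul_subset hV hUopen hK fun v hv => ?_
    obtain ⟨i, hi⟩ := mem_iUnion.1 (hUcover (mem_image_of_mem _ hv))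
    refine ⟨i, fun w hw c e hc he hcK hangles => ?_⟩
    rcases hangles.dichotomy hX hc he with h | ⟨α, hα, hαπ, hle, hchord⟩
    · rwa [h]
    · exact absurd (hlt hw hcK hdist hle) (not_lt.2 hαπ.le)
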